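/- Let $k\ge 3$. For $n\in\mathbb N$ and $p\in[0,1]$ let $\Phi$ be the random $k$-CNF formula on the variables $x_1,\dots,x_n$ in which each of the $2^k\binom nk$ clauses consisting of $k$ literals on $k$ distinct variables is included independently with probability $p$; write $\Pr_p$ for its law. For a CNF formula $\Phi$, regarded as a set of clauses, let $$\mathrm{Spine}(\Phi)=\{x \text{ a literal} : \text{there is a satisfiable } \Xi\subseteq\Phi \text{ such that } \Xi\wedge\overline{x} \text{ is unsatisfiable}\}.$$ Then random $k$-SAT has a first-order phase transition, in the following sense: there exists $\eta>0$ (which may depend on $k$) such that for every sequence $p=p(n)\in[0,1]$, $$\lim_{n\to\infty}\Pr_{p(n)}[\Phi \text{ is satisfiable}]=0 \quad\Longrightarrow\quad \lim_{n\to\infty}\Pr_{p(n)}\left[\frac{|\mathrm{Spine}(\Phi)|}{n}\ge\eta\right]=1 .$$ -/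

import Mathlib

open Filter Topology
open scoped unitInterval

namespace KSAT

/-- A literal over the variables `Fin n`: `(i, true)` is `x_i` and `(i, false)` is its negation. -/
abbrev Literal (n : ℕ) : Type := Fin n × Bool

/-- The complementary literal. -/
def Literal.neg {n : ℕ} (l : Literal n) : Literal n := (l.1, !l.2)

/-- A clause, read as the disjunction of its literals. -/
abbrev Clause (n : ℕ) : Type := Finset (Literal n)

/-- A CNF formula, read as the conjunction of its clauses. -/
abbrev Formula (n : ℕ) : Type := Set (Clause n)

/-- Some truth assignment makes a literal of every clause true. -/
def Satisfiable {n : ℕ} (Φ : Formula n) : Prop :=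
  ∃ a : Fin n → Bool, ∀ C ∈ Φ, ∃ l ∈ C, a l.1 = l.2

/-- The set of literals `x` such that some satisfiable subformula of `Φ` becomes unsatisfiable
when the unit clause consisting of the complement of `x` is added. -/
def spine {n : ℕ} (Φ : Formula n) : Set (Literal n) :=
  {x | ∃ Ξ : Formula n, Ξ ⊆ Φ ∧ Satisfiable Ξ ∧ ¬ Satisfiable (insert {x.neg} Ξ)}

/-- All clauses made of `k` literals on `k` distinct variables; there are `2 ^ k * n.choose k`
of them. -/
def kClauses (k n : ℕ) : Set (Clause n) :=
  {C | C.card = k ∧ Set.InjOn (fun l : Literal n => l.1) (C : Set (Literal n))}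

/-- The law of the random `k`-CNF formula on `n` variables in the constant probability model:
each possible `k`-clause is included independently with probability `p`. -/
noncomputable def randomFormula (k n : ℕ) (p : I) : MeasureTheory.Measure (Formula n) :=
  ProbabilityTheory.setBernoulli (kClauses k n) p

end KSAT

namespace KSAT

/-! An unsatisfiable formula contains a minimally unsatisfiable one, `Ξ`. Deleting a clause of `Ξ`
shows that the negations of its literals lie in the spine, and `Ξ` has no pure literal. So both
literals of each of its `s` variables are in the spine, and `Ξ` has at least `2s/k` clauses on these
variables (`exists_dense_of_not_satisfiable`).

If `p = O(n^(1-k))`, the expected number of such dense spots, raised to the power `k`, is at most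
`(C s/n)^s` as soon as `k ≥ 3` (`pow_expected_dense_le`). Hence whp none has `s < η n`
(`tendsto_sum_denseTerm`), and an unsatisfiable formula has a linear spine.

Larger `p` reduces to this case: the spine grows with the formula, and `unsatProb`, of order
`n^(1-k)`, already gives unsatisfiability whp (`tendsto_satisfiable_unsatProb`). -/

/-! ### Minimally unsatisfiable formulas and the spine -/

lemma spine_mono {n : ℕ} {Φ Ψ : Formula n} (h : Φ ⊆ Ψ) : spine Φ ⊆ spine Ψ :=
  fun _ ⟨Ξ, hΞ, hx⟩ => ⟨Ξ, hΞ.trans h, hx⟩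

@[simp] lemma Literal.neg_neg {n : ℕ} (l : Literal n) : l.neg.neg = l := by
  simp [Literal.neg]

/-- A minimally unsatisfiable formula: removing any clause makes it satisfiable. -/
def MinUnsat {n : ℕ} (Ξ : Formula n) : Prop :=
  ¬ Satisfiable Ξ ∧ ∀ C ∈ Ξ, Satisfiable (Ξ \ {C})

lemma exists_minUnsat_subset {n : ℕ} {Φ : Formula n} (h : ¬ Satisfiable Φ) :
    ∃ Ξ ⊆ Φ, MinUnsat Ξ := by
  obtain ⟨Ξ, hle, hmin⟩ :=
    exists_minimal_le_of_wellFoundedLT (fun Ξ : Formula n => ¬ Satisfiable Ξ) Φ h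
  refine ⟨Ξ, hle, hmin.prop, fun C hC => ?_⟩
  by_contra hC'
  exact (hmin.le_of_le hC' Set.sdiff_subset hC).2 rfl

/-- A model of `Ξ \ {C}` that makes `l` true would also satisfy `C`, hence all of `Ξ`. -/
lemma MinUnsat.neg_mem_spine {n : ℕ} {Ξ Φ : Formula n} (h : MinUnsat Ξ) (hΦ : Ξ ⊆ Φ)
    {C : Clause n} (hC : C ∈ Ξ) {l : Literal n} (hl : l ∈ C) : l.neg ∈ spine Φ := by
  refine ⟨Ξ \ {C}, Set.sdiff_subset.trans hΦ, h.2 C hC, fun ⟨a, ha⟩ => h.1 ⟨a, fun D hD => ?_⟩⟩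
  by_cases hDC : D = C
  · subst hDC
    exact ⟨l, hl, by simpa using ha {l} (by simp)⟩
  · exact ha D (by simp [hD, hDC])

/-- A minimally unsatisfiable formula has no pure literal. -/
lemma MinUnsat.exists_neg_mem {n : ℕ} {Ξ : Formula n} (h : MinUnsat Ξ)
    {C : Clause n} (hC : C ∈ Ξ) {l : Literal n} (hl : l ∈ C) : ∃ D ∈ Ξ, l.neg ∈ D := by
  by_contra! hpure
  obtain ⟨a, ha⟩ := h.2 C hC
  -- Making `l` true repairs `C` and could only break clauses containing `l.neg`, of which there are
  -- none.
  refine h.1 ⟨Function.update a l.1 l.2, fun D hD => ?_⟩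
  by_cases hDC : D = C
  · subst hDC
    exact ⟨l, hl, by simp⟩
  · obtain ⟨x, hx, hax⟩ := ha D (by simp [hD, hDC])
    refine ⟨x, hx, ?_⟩
    by_cases hxl : x.1 = l.1
    · have hne : x ≠ l.neg := fun e => hpure D hD (e ▸ hx)
      rw [hxl, Function.update_self]
      by_contra hne'
      refine hne (Prod.ext hxl ?_)
      simp only [Literal.neg]
      revert hne'
      cases l.2 <;> cases x.2 <;> simp
    · rw [Function.update_of_ne hxl, hax]

/-- The sets of `k` literals over the variables in `V`. -/
def clausesOn {n : ℕ} (k : ℕ) (V : Finset (Fin n)) : Finset (Clause n) :=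
  (V ×ˢ Finset.univ).powersetCard k

lemma card_clausesOn {n : ℕ} (k : ℕ) (V : Finset (Fin n)) :
    (clausesOn k V).card = (2 * V.card).choose k := by
  simp [clausesOn, mul_comm]

/-- An unsatisfiable `k`-CNF formula contains many clauses on at most as many variables as its
spine has literals. -/
lemma exists_dense_of_not_satisfiable {n k : ℕ} (hk : 0 < k) {Φ : Formula n}
    (hΦ : Φ ⊆ kClauses k n) (h : ¬ Satisfiable Φ) :
    ∃ V : Finset (Fin n), 1 ≤ V.card ∧ V.card ≤ (spine Φ).ncard ∧
      ∃ T ⊆ clausesOn k V, (T : Set (Clause n)) ⊆ Φ ∧ 2 * V.card ≤ T.card * k := by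
  classical
  obtain ⟨Ξ, hΞ, hmin⟩ := exists_minUnsat_subset h
  set T : Finset (Clause n) := (Set.toFinite Ξ).toFinset with hT
  have hmem : ∀ {C}, C ∈ T ↔ C ∈ Ξ := by simp [hT]
  set L : Finset (Literal n) := T.biUnion id with hL
  have hmemL : ∀ {l}, l ∈ L ↔ ∃ C ∈ Ξ, l ∈ C := by simp [hL, hmem]
  have hneg : ∀ {l}, l ∈ L → l.neg ∈ L := fun {l} hl => by
    obtain ⟨C, hC, hlC⟩ := hmemL.1 hl
    exact hmemL.2 (hmin.exists_neg_mem hC hlC)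
  set V : Finset (Fin n) := L.image Prod.fst with hV
  have hcard : ∀ C ∈ T, C.card = k := fun C hC => (hΦ (hΞ (hmem.1 hC))).1
  -- Closure under negation makes the count `2 * V.card` exact.
  have hVL : V ×ˢ Finset.univ = L := by
    ext ⟨i, b⟩
    simp only [hV, Finset.mem_product, Finset.mem_image, Finset.mem_univ, and_true]
    refine ⟨?_, fun hl => ⟨_, hl, rfl⟩⟩
    rintro ⟨⟨j, c⟩, hl, rfl⟩
    have h' := hneg hl
    simp only [Literal.neg] at h'
    cases b <;> cases c <;> simp_all
  have hLcard : L.card = 2 * V.card := by rw [← hVL]; simp [mul_comm]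
  have hsp : L.card ≤ (spine Φ).ncard := by
    rw [← Set.ncard_coe_finset]
    refine Set.ncard_le_ncard (fun l hl => ?_) (Set.toFinite _)
    obtain ⟨C, hC, hlC⟩ := hmemL.1 (hneg hl)
    simpa using hmin.neg_mem_spine hΞ hC hlC
  refine ⟨V, ?_, by omega, T, fun C hC => ?_, fun C hC => hΞ (hmem.1 hC), ?_⟩
  · have : Ξ.Nonempty := by
      rw [Set.nonempty_iff_ne_empty]
      rintro rfl
      exact hmin.1 ⟨fun _ => true, by simp⟩
    obtain ⟨C, hC⟩ := this
    obtain ⟨l, hl⟩ := Finset.card_pos.1 (hk.trans_eq (hcard C (hmem.2 hC)).symm)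
    exact Finset.card_pos.2 ⟨_, Finset.mem_image_of_mem _ (hmemL.2 ⟨C, hC, hl⟩)⟩
  · rw [clausesOn, hVL, Finset.mem_powersetCard]
    exact ⟨fun l hl => hmemL.2 ⟨C, hmem.1 hC, hl⟩, hcard C hC⟩
  · rw [← hLcard]
    exact Finset.card_biUnion_le_card_mul _ _ _ fun C hC => (hcard C hC).le

/-! ### Monotone coupling of Bernoulli random sets -/

section Bernoulli
open MeasureTheory Measure ProbabilityTheory

variable {ι : Type*}

/-- The random set of all indices in `u` whose uniform label is at most `p`. -/
def thresholdSet (u : Set ι) (p : I) (x : ι → I) : Set ι := {i | i ∈ u ∧ x i ≤ p}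

lemma thresholdSet_mono (u : Set ι) {p q : I} (h : p ≤ q) (x : ι → I) :
    thresholdSet u p x ⊆ thresholdSet u q x :=
  fun _ hi => ⟨hi.1, hi.2.trans h⟩

lemma measurable_mem_and_le (P : Prop) (p : I) : Measurable fun x : I => P ∧ x ≤ p :=
  measurableSet_setOfPred.1 ((MeasurableSet.const P).inter measurableSet_Iic)

lemma map_mem_and_le (P : Prop) (p : I) :
    (volume : Measure I).map (fun x => P ∧ x ≤ p) =
      unitInterval.toNNReal p • dirac P + unitInterval.toNNReal (σ p) • dirac False := by
  have hm : Measurable fun x : I => P ∧ x ≤ p := measurable_mem_and_le P p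
  ext s hs
  rw [map_apply hm hs]
  by_cases hP : P
  · have h1 : ((unitInterval.toNNReal p : NNReal) : ENNReal) = ENNReal.ofReal p := by
      rw [ENNReal.ofReal]; congr 1; ext; simp [Real.toNNReal_of_nonneg p.2.1]
    have h2 : ((unitInterval.toNNReal (σ p) : NNReal) : ENNReal) = ENNReal.ofReal (1 - p) := by
      rw [ENNReal.ofReal]; congr 1; ext; simp [p.2.2]
    by_cases ht : True ∈ s <;> by_cases hf : False ∈ s
    · have : (fun x : I => P ∧ x ≤ p) ⁻¹' s = Set.univ := by
        ext x; by_cases hx : x ≤ p <;> simp [hP, hx, ht, hf]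
      rw [this]
      simp [hP, ht, hf, ← ENNReal.coe_add]
    · have : (fun x : I => P ∧ x ≤ p) ⁻¹' s = Set.Iic p := by
        ext x; by_cases hx : x ≤ p <;> simp [hP, hx, ht, hf]
      rw [this]
      simp [hP, ht, hf, unitInterval.volume_Iic, ← h1]
    · have : (fun x : I => P ∧ x ≤ p) ⁻¹' s = Set.Ioi p := by
        ext x; by_cases hx : x ≤ p <;> simp [hP, hx, ht, hf, ← not_le]
      rw [this]
      simp [hP, ht, hf, unitInterval.volume_Ioi, ← h2]
    · have : (fun x : I => P ∧ x ≤ p) ⁻¹' s = ∅ := by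
        ext x; by_cases hx : x ≤ p <;> simp [hP, hx, ht, hf]
      rw [this]
      simp [hP, ht, hf]
  · by_cases hf : False ∈ s <;> simp [hP, hf, ← ENNReal.coe_add]

lemma measurable_thresholdSet (u : Set ι) (p : I) : Measurable (thresholdSet u p) := by
  have : Measurable fun (x : ι → I) (i : ι) => (i ∈ u ∧ x i ≤ p) :=
    measurable_pi_iff.2 fun i => (measurable_mem_and_le (i ∈ u) p).comp (measurable_pi_apply i)
  exact MeasurableEquiv.setOfPred.measurable.comp this

/-- Bernoulli random sets for all parameters at once, coupled through uniform labels. -/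
lemma setBernoulli_eq_map_thresholdSet (u : Set ι) (p : I) :
    setBernoulli u p = (infinitePi fun _ : ι => (volume : Measure I)).map (thresholdSet u p) := by
  have hm : ∀ i, Measurable fun x : I => (i ∈ u ∧ x ≤ p) := fun i =>
    measurable_mem_and_le (i ∈ u) p
  rw [setBernoulli_eq_map]
  simp_rw [← map_mem_and_le]
  rw [← infinitePi_map_pi (fun _ : ι => (volume : Measure I)) hm]
  exact map_map MeasurableEquiv.setOfPred.measurable
    (measurable_pi_iff.2 fun i => (hm i).comp (measurable_pi_apply i))

lemma setBernoulli_real_mono [Finite ι] (u : Set ι) {p q : I} (h : p ≤ q) {S : Set (Set ι)}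
    (hS : ∀ s t, s ⊆ t → s ∈ S → t ∈ S) :
    (setBernoulli u p).real S ≤ (setBernoulli u q).real S := by
  have hmS : MeasurableSet S := S.toFinite.measurableSet
  simp only [setBernoulli_eq_map_thresholdSet]
  rw [map_measureReal_apply (measurable_thresholdSet u p) hmS,
    map_measureReal_apply (measurable_thresholdSet u q) hmS]
  exact measureReal_mono fun x hx => hS _ _ (thresholdSet_mono u h x) hx

/-- Only an inequality, since `T` may leave `u`, where the event has probability zero. -/
lemma setBernoulli_real_superset_le [Finite ι] (u : Set ι) (p : I) (T : Finset ι) :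
    (setBernoulli u p).real {s | (T : Set ι) ⊆ s} ≤ (p : ℝ) ^ T.card := by
  rw [setBernoulli_eq_map_thresholdSet,
    map_measureReal_apply (measurable_thresholdSet u p) (Set.toFinite _).measurableSet]
  calc _ ≤ (infinitePi fun _ : ι => (volume : Measure I)).real
        (Set.pi T fun _ => Set.Iic p) := measureReal_mono fun x hx i hi => (hx hi).2
    _ = _ := by
        rw [measureReal_def, infinitePi_pi _ fun _ _ => measurableSet_Iic]
        simp [unitInterval.volume_Iic, p.2.1]

lemma setBernoulli_real_disjoint_le [Finite ι] (u : Set ι) (p : I) (T : Finset ι)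
    (hT : (T : Set ι) ⊆ u) :
    (setBernoulli u p).real {s | ∀ i ∈ T, i ∉ s} ≤ (1 - p : ℝ) ^ T.card := by
  rw [setBernoulli_eq_map_thresholdSet,
    map_measureReal_apply (measurable_thresholdSet u p) (Set.toFinite _).measurableSet]
  calc _ ≤ (infinitePi fun _ : ι => (volume : Measure I)).real
        (Set.pi T fun _ => Set.Ioi p) := measureReal_mono fun x hx i hi =>
          not_le.1 fun hle => (show ∀ i ∈ T, i ∉ thresholdSet u p x from hx) i hi ⟨hT hi, hle⟩
    _ = _ := by
        rw [measureReal_def, infinitePi_pi _ fun _ _ => measurableSet_Ioi]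
        simp [unitInterval.volume_Ioi, p.2.2]

end Bernoulli

/-! ### First moment bounds for random formulas -/

/-- The clause violated by the assignment `a` on the variables in `S`. -/
def violatedClause {n : ℕ} (a : Fin n → Bool) (S : Finset (Fin n)) : Clause n :=
  S.map ⟨fun i => (i, !a i), fun _ _ h => congrArg Prod.fst h⟩

lemma violatedClause_injective {n : ℕ} (a : Fin n → Bool) :
    Function.Injective (violatedClause a) :=
  Finset.map_injective _

lemma violatedClause_mem_kClauses {n k : ℕ} (a : Fin n → Bool) {S : Finset (Fin n)}
    (hS : S.card = k) : violatedClause a S ∈ kClauses k n := by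
  refine ⟨by simp [violatedClause, hS], ?_⟩
  intro x hx y hy hxy
  obtain ⟨i, -, rfl⟩ := Finset.mem_map.1 (Finset.mem_coe.1 hx)
  obtain ⟨j, -, rfl⟩ := Finset.mem_map.1 (Finset.mem_coe.1 hy)
  exact congrArg (fun i => (i, !a i)) hxy

lemma not_satisfies_violatedClause {n : ℕ} (a : Fin n → Bool) (S : Finset (Fin n)) :
    ¬ ∃ l ∈ violatedClause a S, a l.1 = l.2 := by
  rintro ⟨l, hl, h⟩
  obtain ⟨i, -, rfl⟩ := Finset.mem_map.1 hl
  exact Bool.not_ne_self _ h.symm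

open MeasureTheory ProbabilityTheory

instance {k n : ℕ} {p : I} : IsProbabilityMeasure (randomFormula k n p) := by
  unfold randomFormula; infer_instance

/-- First moment bound on the probability of satisfiability. -/
lemma randomFormula_satisfiable_le (k n : ℕ) (p : I) :
    (randomFormula k n p).real {Φ | Satisfiable Φ} ≤ 2 ^ n * (1 - p : ℝ) ^ n.choose k := by
  classical
  have hsub : {Φ : Formula n | Satisfiable Φ} ⊆ ⋃ a : Fin n → Bool,
      {Φ | ∀ C ∈ (Finset.univ.powersetCard k).image (violatedClause a), C ∉ Φ} := by
    rintro Φ ⟨a, ha⟩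
    refine Set.mem_iUnion.2 ⟨a, fun C hC hCΦ => ?_⟩
    obtain ⟨S, -, rfl⟩ := Finset.mem_image.1 hC
    exact not_satisfies_violatedClause a S (ha _ hCΦ)
  calc _ ≤ ∑ a : Fin n → Bool, (randomFormula k n p).real
        {Φ | ∀ C ∈ (Finset.univ.powersetCard k).image (violatedClause a), C ∉ Φ} :=
      (measureReal_mono hsub).trans (measureReal_iUnion_fintype_le _)
    _ ≤ ∑ _a : Fin n → Bool, (1 - p : ℝ) ^ n.choose k := by
      refine Finset.sum_le_sum fun a _ => ?_
      refine (setBernoulli_real_disjoint_le _ p _ fun C hC => ?_).trans_eq ?_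
      · obtain ⟨S, hS, rfl⟩ := Finset.mem_image.1 (Finset.mem_coe.1 hC)
        exact violatedClause_mem_kClauses a (Finset.mem_powersetCard.1 hS).2
      · rw [Finset.card_image_of_injective _ (violatedClause_injective a)]
        simp
    _ = _ := by simp

/-- The formula has at least `m` clauses on some set of `s` variables. -/
def HasDense {n : ℕ} (k s m : ℕ) (Φ : Formula n) : Prop :=
  ∃ V : Finset (Fin n), V.card = s ∧ ∃ T ⊆ clausesOn k V, T.card = m ∧ (T : Set (Clause n)) ⊆ Φ

/-- Union bound over `V` and `T`. Sets of literals repeating a variable are counted too, which only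
weakens the bound. -/
lemma randomFormula_hasDense_le (k n s m : ℕ) (p : I) :
    (randomFormula k n p).real {Φ | HasDense k s m Φ} ≤
      n.choose s * (((2 * s).choose k).choose m * (p : ℝ) ^ m) := by
  have hsub : {Φ : Formula n | HasDense k s m Φ} ⊆
      ⋃ V ∈ (Finset.univ : Finset (Fin n)).powersetCard s,
        ⋃ T ∈ (clausesOn k V).powersetCard m, {Φ | (T : Set (Clause n)) ⊆ Φ} := by
    rintro Φ ⟨V, hV, T, hT, hTm, hTΦ⟩
    simp only [Set.mem_iUnion, Finset.mem_powersetCard]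
    exact ⟨V, ⟨Finset.subset_univ V, hV⟩, T, ⟨hT, hTm⟩, hTΦ⟩
  calc _ ≤ ∑ V ∈ (Finset.univ : Finset (Fin n)).powersetCard s,
        ∑ T ∈ (clausesOn k V).powersetCard m,
          (randomFormula k n p).real {Φ | (T : Set (Clause n)) ⊆ Φ} :=
      ((measureReal_mono hsub (measure_ne_top _ _)).trans (measureReal_biUnion_finset_le _ _)).trans
        (Finset.sum_le_sum fun V _ => measureReal_biUnion_finset_le _ _)
    _ ≤ ∑ V ∈ (Finset.univ : Finset (Fin n)).powersetCard s,
        ∑ T ∈ (clausesOn k V).powersetCard m, (p : ℝ) ^ m := by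
      refine Finset.sum_le_sum fun V _ => Finset.sum_le_sum fun T hT => ?_
      rw [← (Finset.mem_powersetCard.1 hT).2]
      exact setBernoulli_real_superset_le _ p T
    _ = ∑ V ∈ (Finset.univ : Finset (Fin n)).powersetCard s,
        (((2 * s).choose k).choose m * (p : ℝ) ^ m) := by
      refine Finset.sum_congr rfl fun V hV => ?_
      rw [Finset.sum_const, Finset.card_powersetCard, card_clausesOn,
        (Finset.mem_powersetCard.1 hV).2, nsmul_eq_mul]
    _ = _ := by simp

/-- The expected number of pairs of `s` variables and `⌈2 s / k⌉` clauses on them, up to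
truncation to `1 ≤ s < η n`. -/
noncomputable def denseTerm (k : ℕ) (η : ℝ) (n : ℕ) (p : ℝ) (s : ℕ) : ℝ :=
  if 1 ≤ s ∧ (s : ℝ) < η * n then
    n.choose s * (((2 * s).choose k).choose (2 * s ⌈/⌉ k) * p ^ (2 * s ⌈/⌉ k)) else 0

lemma one_le_sat_add_spine_add_dense {k n : ℕ} (hk : 0 < k) (hn : 0 < n) (p : I) (η : ℝ) :
    1 ≤ (randomFormula k n p).real {Φ | Satisfiable Φ} +
      (randomFormula k n p).real {Φ | η ≤ ((spine Φ).ncard : ℝ) / n} +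
      ∑ s ∈ Finset.range (n + 1), denseTerm k η n p s := by
  classical
  set μ := randomFormula k n p
  set F : Finset ℕ := (Finset.range (n + 1)).filter fun s => 1 ≤ s ∧ (s : ℝ) < η * n with hF
  set D : Set (Formula n) := ⋃ s ∈ F, {Φ | HasDense k s (2 * s ⌈/⌉ k) Φ}
  have hcov : ∀ᵐ Φ ∂μ, Φ ∈ (Set.univ : Set (Formula n)) → Φ ∈ ({Φ | Satisfiable Φ} ∪
      {Φ | η ≤ ((spine Φ).ncard : ℝ) / n}) ∪ D := by
    filter_upwards [setBernoulli_ae_subset (u := kClauses k n) (p := p)] with Φ hΦ _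
    by_contra! h
    simp only [Set.mem_union, not_or, Set.mem_ofPred_eq, not_le] at h
    obtain ⟨⟨hsat, hsp⟩, hD⟩ := h
    obtain ⟨V, hV1, hVsp, T, hT, hTΦ, hcard⟩ := exists_dense_of_not_satisfiable hk hΦ hsat
    refine hD (Set.mem_biUnion (x := V.card) ?_ ?_)
    · rw [hF, Finset.coe_filter]
      refine ⟨?_, hV1, ?_⟩
      · have := V.card_le_univ
        simp at this ⊢; omega
      · rw [div_lt_iff₀ (by positivity)] at hsp
        exact lt_of_le_of_lt (by exact_mod_cast hVsp) hsp
    -- Trimming to exactly `⌈2s/k⌉` clauses leaves one event per `s` in the union bound.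
    · obtain ⟨T', hT', hT'm⟩ := Finset.exists_subset_card_eq
        (show 2 * V.card ⌈/⌉ k ≤ T.card from ceilDiv_le_iff_le_mul hk |>.2 (by linarith))
      exact ⟨V, rfl, T', hT'.trans hT, hT'm, (Finset.coe_subset.2 hT').trans hTΦ⟩
  have h1 : (1 : ℝ) = μ.real Set.univ := by simp [μ]
  have hD : μ.real D ≤ ∑ s ∈ Finset.range (n + 1), denseTerm k η n p s := by
    simp only [denseTerm]
    rw [← Finset.sum_filter]
    exact (measureReal_biUnion_finset_le _ _).trans
      (Finset.sum_le_sum fun s _ => randomFormula_hasDense_le k n s _ p)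
  calc (1 : ℝ) = μ.real Set.univ := h1
    _ ≤ μ.real (({Φ | Satisfiable Φ} ∪ {Φ | η ≤ ((spine Φ).ncard : ℝ) / n}) ∪ D) :=
      ENNReal.toReal_mono (measure_ne_top _ _) (measure_mono_ae hcov)
    _ ≤ _ := (measureReal_union_le _ _).trans
      (add_le_add (measureReal_union_le _ _) hD)

/-! ### Estimates for dense subformulas -/

open Nat in
lemma inv_factorial_le (m : ℕ) (hm : 0 < m) : ((m ! : ℝ))⁻¹ ≤ (Real.exp 1 / m) ^ m := by
  have h := Real.pow_div_factorial_le_exp (x := m) (by positivity) m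
  have hm' : (0 : ℝ) < m := by exact_mod_cast hm
  rw [div_pow, ← Real.exp_nat_mul, mul_one, le_div_iff₀ (by positivity)]
  rwa [mul_comm, ← div_eq_mul_inv]

lemma choose_le_exp_mul_div_pow (N m : ℕ) (hm : 0 < m) :
    (N.choose m : ℝ) ≤ (Real.exp 1 * N / m) ^ m := by
  calc (N.choose m : ℝ) ≤ N ^ m / (m.factorial : ℝ) := Nat.choose_le_pow_div m N
    _ ≤ N ^ m * (Real.exp 1 / m) ^ m := by
        rw [div_eq_mul_inv]; gcongr; exact inv_factorial_le m hm
    _ = _ := by rw [← mul_pow]; congr 1; ring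

/-- The constant controlling the number of clauses on few variables. -/
noncomputable def clauseConst (k : ℕ) (D : ℝ) : ℝ := Real.exp 1 * k * 2 ^ k * D

/-- The constant controlling the number of dense subformulas on few variables. -/
noncomputable def denseConst (k : ℕ) (D : ℝ) : ℝ := Real.exp 1 ^ k * clauseConst k D ^ 2

lemma one_le_clauseConst {k : ℕ} {D : ℝ} (hk : 0 < k) (hD : 1 ≤ D) : 1 ≤ clauseConst k D := by
  have h1 : (1 : ℝ) ≤ Real.exp 1 := Real.one_le_exp (by norm_num)
  have h2 : (1 : ℝ) ≤ k := by exact_mod_cast hk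
  have h3 : (1 : ℝ) ≤ 2 ^ k := one_le_pow₀ (by norm_num)
  exact one_le_mul_of_one_le_of_one_le (one_le_mul_of_one_le_of_one_le
    (one_le_mul_of_one_le_of_one_le h1 h2) h3) hD

lemma clauseConst_le_denseConst {k : ℕ} {D : ℝ} (hk : 0 < k) (hD : 1 ≤ D) :
    clauseConst k D ≤ denseConst k D := by
  have h1 : (1 : ℝ) ≤ Real.exp 1 ^ k := one_le_pow₀ (Real.one_le_exp (by norm_num))
  have hA := one_le_clauseConst hk hD
  unfold denseConst
  nlinarith [mul_le_mul h1 (le_refl (clauseConst k D ^ 2)) (by positivity) (by positivity)]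

lemma choose_clauses_mul_pow_le {k n s m : ℕ} {D p : ℝ} (hk : 1 ≤ k) (hs : 0 < s) (hm : 0 < m)
    (hn : 0 < n) (hsm : 2 * s ≤ k * m) (hD : 0 ≤ D) (hp0 : 0 ≤ p) (hp : p ≤ D / n ^ (k - 1)) :
    (((2 * s).choose k).choose m : ℝ) * p ^ m ≤
      (clauseConst k D * ((s : ℝ) / n) ^ (k - 1)) ^ m := by
  refine (mul_le_mul_of_nonneg_right (choose_le_exp_mul_div_pow _ m hm)
    (pow_nonneg hp0 m)).trans ?_
  rw [← mul_pow]
  have hm' : (0 : ℝ) < m := by exact_mod_cast hm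
  have hn' : (0 : ℝ) < n := by exact_mod_cast hn
  have hs' : (0 : ℝ) < s := by exact_mod_cast hs
  have hsm' : 2 * (s : ℝ) ≤ k * m := by exact_mod_cast hsm
  refine pow_le_pow_left₀ (by positivity) ?_ m
  have hN : (((2 * s).choose k : ℕ) : ℝ) ≤ (2 * s) ^ k := by
    exact_mod_cast Nat.choose_le_pow (2 * s) k
  -- Since `m ≥ 2s/k`, dividing by `m` gains one factor `s`.
  have hNm : (((2 * s).choose k : ℕ) : ℝ) / m ≤ k * (2 * s) ^ (k - 1) := by
    rw [div_le_iff₀ hm']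
    calc _ ≤ (2 * (s : ℝ)) ^ k := hN
      _ = (2 * s) ^ (k - 1) * (2 * s) := by rw [← pow_succ, Nat.sub_add_cancel hk]
      _ ≤ (2 * s) ^ (k - 1) * (k * m) := by gcongr
      _ = _ := by ring
  calc Real.exp 1 * (((2 * s).choose k : ℕ) : ℝ) / m * p
      = Real.exp 1 * ((((2 * s).choose k : ℕ) : ℝ) / m) * p := by ring
    _ ≤ Real.exp 1 * (k * (2 * s) ^ (k - 1)) * (D / n ^ (k - 1)) := by gcongr
    _ = Real.exp 1 * k * 2 ^ (k - 1) * D * ((s : ℝ) / n) ^ (k - 1) := by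
        rw [mul_pow, div_pow]; ring
    _ ≤ Real.exp 1 * k * 2 ^ k * D * ((s : ℝ) / n) ^ (k - 1) := by
        gcongr
        · norm_num
        · omega

/-- The `k`-th power avoids the fractional exponent `2s/k`. With `x = s/n`, choosing the variables
costs `x^(-k)` per variable and the clauses gain `x^(2(k-1))`. The net exponent `k - 2` is positive
exactly because `k ≥ 3`. -/
lemma pow_expected_dense_le {k n s m : ℕ} {D p : ℝ} (hk : 3 ≤ k) (hs : 0 < s) (hm : 0 < m)
    (hn : 0 < n) (hsm : 2 * s ≤ k * m) (hD : 1 ≤ D) (hp0 : 0 ≤ p) (hp : p ≤ D / n ^ (k - 1))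
    (hE : denseConst k D * (s / n) ≤ 1) :
    (n.choose s * (((2 * s).choose k).choose m * p ^ m) : ℝ) ^ k ≤
      (denseConst k D * (s / n)) ^ s := by
  have hn' : (0 : ℝ) < n := by exact_mod_cast hn
  have hs' : (0 : ℝ) < s := by exact_mod_cast hs
  have hx : (0 : ℝ) < s / n := by positivity
  have hA := one_le_clauseConst (k := k) (by omega) hD
  have hAE := clauseConst_le_denseConst (k := k) (by omega) hD
  generalize hxd : (s : ℝ) / n = x at *
  set A := clauseConst k D with hAd
  have hAx : A * x ≤ 1 := (mul_le_mul_of_nonneg_right hAE hx.le).trans hE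
  have hx1 : x ≤ 1 := by nlinarith
  have hy : A * x ^ (k - 1) ≤ 1 := by
    refine le_trans ?_ hAx
    gcongr
    exact pow_le_of_le_one hx.le hx1 (by omega)
  have h1 : (n.choose s : ℝ) ≤ (Real.exp 1 / x) ^ s := by
    convert choose_le_exp_mul_div_pow n s hs using 2
    rw [← hxd]; field_simp
  have h2 : (((2 * s).choose k).choose m : ℝ) * p ^ m ≤ (A * x ^ (k - 1)) ^ m := by
    rw [← hxd]
    exact choose_clauses_mul_pow_le (by omega) hs hm hn hsm (by linarith) hp0 hp
  have hy0 : 0 ≤ A * x ^ (k - 1) := by positivity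
  calc _ ≤ ((Real.exp 1 / x) ^ s * (A * x ^ (k - 1)) ^ m) ^ k := by gcongr
    _ = (Real.exp 1 / x) ^ (s * k) * (A * x ^ (k - 1)) ^ (k * m) := by
        rw [mul_pow, ← pow_mul, ← pow_mul, mul_comm m k]
    _ ≤ (Real.exp 1 / x) ^ (s * k) * (A * x ^ (k - 1)) ^ (2 * s) := by
        gcongr ?_ * ?_
        exact pow_le_pow_of_le_one hy0 hy hsm
    _ = (Real.exp 1 ^ k * A ^ 2 * ((x ^ (k - 1)) ^ 2 / x ^ k)) ^ s := by
        rw [mul_comm s k, pow_mul, pow_mul, ← mul_pow]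
        congr 1
        rw [mul_pow, div_pow]; ring
    _ ≤ (Real.exp 1 ^ k * A ^ 2 * x) ^ s := by
        gcongr
        rw [div_le_iff₀ (by positivity), ← pow_succ', ← pow_mul]
        exact pow_le_pow_of_le_one hx.le hx1 (by omega)
    _ = _ := rfl

/-- The density threshold below which dense subformulas are unlikely. -/
noncomputable def spineDensity (k : ℕ) (D : ℝ) : ℝ := (2 ^ k * denseConst k D)⁻¹

lemma denseConst_pos {k : ℕ} {D : ℝ} (hk : 0 < k) (hD : 1 ≤ D) : 0 < denseConst k D :=
  (zero_lt_one.trans_le (one_le_clauseConst hk hD)).trans_le (clauseConst_le_denseConst hk hD)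

lemma spineDensity_pos {k : ℕ} {D : ℝ} (hk : 0 < k) (hD : 1 ≤ D) : 0 < spineDensity k D := by
  have := denseConst_pos hk hD
  unfold spineDensity
  positivity

lemma denseTerm_nonneg {k n s : ℕ} {η p : ℝ} (hp : 0 ≤ p) : 0 ≤ denseTerm k η n p s := by
  unfold denseTerm
  split_ifs <;> positivity

/-- Of the two bounds in the minimum, the first gives a summable majorant uniform in `n`, the second
the limit zero for fixed `s`. -/
lemma denseTerm_pow_le {k n s : ℕ} {D p : ℝ} (hk : 3 ≤ k) (hs : 0 < s)
    (hD : 1 ≤ D) (hp0 : 0 ≤ p) (hp : p ≤ D / n ^ (k - 1)) :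
    denseTerm k (spineDensity k D) n p s ^ k ≤
      min ((1 / 2) ^ k) (denseConst k D * (s / n)) ^ s := by
  have hE := denseConst_pos (k := k) (by omega) hD
  unfold denseTerm
  split_ifs with h
  · have hn : 0 < n := by
      rcases Nat.eq_zero_or_pos n with rfl | hn
      · have := h.2
        simp only [Nat.cast_zero, mul_zero] at this
        exact absurd this (not_lt.2 (Nat.cast_nonneg s))
      · exact hn
    have hn' : (0 : ℝ) < n := by exact_mod_cast hn
    -- This is what the factor `2 ^ k` in `spineDensity` is for.
    have hb : denseConst k D * (s / n) ≤ (1 / 2) ^ k := by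
      have h2 := h.2
      rw [spineDensity, ← div_eq_inv_mul, lt_div_iff₀ (by positivity)] at h2
      rw [one_div, inv_pow, le_inv_comm₀ (by positivity) (by have := hs; positivity)]
      rw [le_inv_comm₀ (by positivity) (by positivity), mul_div_assoc', div_le_iff₀ hn',
        ← div_eq_inv_mul, le_div_iff₀ (by positivity)]
      nlinarith
    rw [min_eq_right hb]
    have hc : 2 * s ≤ k * (2 * s ⌈/⌉ k) := (ceilDiv_le_iff_le_mul (by omega : 0 < k)).1 le_rfl
    refine pow_expected_dense_le hk hs ?_ hn hc hD hp0 hp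
      (hb.trans (pow_le_one₀ (by norm_num) (by norm_num)))
    rw [Nat.pos_iff_ne_zero]
    intro h0
    rw [h0] at hc
    omega
  · rw [zero_pow (by omega)]
    positivity

lemma denseTerm_le_half_pow {k n s : ℕ} {D p : ℝ} (hk : 3 ≤ k)
    (hD : 1 ≤ D) (hp0 : 0 ≤ p) (hp : p ≤ D / n ^ (k - 1)) :
    denseTerm k (spineDensity k D) n p s ≤ (1 / 2) ^ s := by
  rcases Nat.eq_zero_or_pos s with rfl | hs
  · simp [denseTerm]
  have hE := denseConst_pos (k := k) (by omega) hD
  refine le_of_pow_le_pow_left₀ (n := k) (by omega) (by positivity) ?_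
  refine (denseTerm_pow_le hk hs hD hp0 hp).trans ?_
  rw [← pow_mul, mul_comm s k, pow_mul]
  gcongr
  exact min_le_left _ _

/-- Small dense subformulas are unlikely in sparse random formulas. -/
lemma tendsto_sum_denseTerm {k : ℕ} {D : ℝ} (hk : 3 ≤ k) (hD : 1 ≤ D) (p : ℕ → ℝ)
    (hp0 : ∀ n, 0 ≤ p n) (hp : ∀ n, p n ≤ D / n ^ (k - 1)) :
    Tendsto (fun n => ∑ s ∈ Finset.range (n + 1), denseTerm k (spineDensity k D) n (p n) s)
      atTop (𝓝 0) := by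
  set f := fun n s => denseTerm k (spineDensity k D) n (p n) s with hf
  have hfb : ∀ n s, f n s ≤ (1 / 2) ^ s := fun n s => denseTerm_le_half_pow hk hD (hp0 n) (hp n)
  have hf0 : ∀ n s, 0 ≤ f n s := fun n s => denseTerm_nonneg (hp0 n)
  have hsum : Summable fun s : ℕ => (1 / 2 : ℝ) ^ s := summable_geometric_two
  have hlim : ∀ s, Tendsto (fun n => f n s) atTop (𝓝 0) := fun s => by
    rcases Nat.eq_zero_or_pos s with rfl | hs
    · simp [hf, denseTerm]
    have h1 : Tendsto (fun n : ℕ => denseConst k D * ((s : ℝ) / n)) atTop (𝓝 0) := by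
      simpa using (tendsto_const_div_atTop_nhds_zero_nat (s : ℝ)).const_mul (denseConst k D)
    have h2 : Tendsto (fun n => f n s ^ k) atTop (𝓝 0) := by
      refine squeeze_zero (fun n => pow_nonneg (hf0 n s) k)
        (fun n => denseTerm_pow_le hk hs hD (hp0 n) (hp n)) ?_
      have h3 := ((tendsto_const_nhds (x := ((1 / 2 : ℝ) ^ k))).min h1).pow s
      rwa [min_eq_right (by positivity), zero_pow hs.ne'] at h3
    have h4 := h2.rpow_const (p := (k : ℝ)⁻¹) (Or.inr (by positivity))
    rw [Real.zero_rpow (by have : 0 < k := by omega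
                           positivity)] at h4
    exact h4.congr fun n => Real.pow_rpow_inv_natCast (hf0 n s) (by omega)
  -- Dominated convergence, with the geometric majorant.
  have ht : Tendsto (fun n => ∑' s, f n s) atTop (𝓝 0) := by
    simpa using tendsto_tsum_of_dominated_convergence hsum hlim
      (Eventually.of_forall fun n s => by
        rw [Real.norm_of_nonneg (hf0 n s)]; exact hfb n s)
  exact squeeze_zero (fun n => Finset.sum_nonneg fun s _ => hf0 n s)
    (fun n => (Summable.of_nonneg_of_le (hf0 n) (hfb n) hsum).sum_le_tsum _
      fun s _ => hf0 n s) ht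

/-! ### A sparse regime that is already unsatisfiable -/

/-- The density constant beyond which the first moment of satisfying assignments vanishes. -/
noncomputable def unsatConst (k : ℕ) : ℝ := 2 ^ k * k.factorial

/-- The clause probability `unsatConst k / n ^ (k - 1)`, truncated to the unit interval. -/
noncomputable def unsatProb (k n : ℕ) : I :=
  Set.projIcc 0 1 zero_le_one (unsatConst k / n ^ (k - 1))

lemma one_le_unsatConst (k : ℕ) : 1 ≤ unsatConst k :=
  one_le_mul_of_one_le_of_one_le (one_le_pow₀ (by norm_num))
    (by exact_mod_cast Nat.factorial_pos k)

lemma unsatProb_le (k n : ℕ) : (unsatProb k n : ℝ) ≤ unsatConst k / n ^ (k - 1) := by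
  have : 0 ≤ unsatConst k / (n : ℝ) ^ (k - 1) :=
    div_nonneg (zero_le_one.trans (one_le_unsatConst k)) (by positivity)
  rw [unsatProb, Set.coe_projIcc]
  exact max_le this (min_le_right _ _)

lemma eventually_unsatProb_eq {k : ℕ} (hk : 2 ≤ k) :
    ∀ᶠ n : ℕ in atTop, (unsatProb k n : ℝ) = unsatConst k / n ^ (k - 1) := by
  have h : Tendsto (fun n : ℕ => unsatConst k / (n : ℝ) ^ (k - 1)) atTop (𝓝 0) :=
    tendsto_const_nhds.div_atTop
      ((tendsto_pow_atTop (by omega)).comp tendsto_natCast_atTop_atTop)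
  filter_upwards [h.eventually_le_const one_pos] with n hn
  have : 0 ≤ unsatConst k / (n : ℝ) ^ (k - 1) :=
    div_nonneg (zero_le_one.trans (one_le_unsatConst k)) (by positivity)
  rw [unsatProb, Set.coe_projIcc, min_eq_right hn, max_eq_right this]

/-- `unsatConst` is chosen to cancel the `2 ^ k * k!` in `(n/2)^k / k! ≤ n.choose k`, valid for `n ≥
2k`. -/
lemma eventually_le_unsatProb_mul_choose {k : ℕ} (hk : 2 ≤ k) :
    ∀ᶠ n : ℕ in atTop, (n : ℝ) ≤ unsatProb k n * n.choose k := by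
  filter_upwards [eventually_unsatProb_eq hk, eventually_ge_atTop (2 * k)] with n hp hn
  have hn0 : (0 : ℝ) < n := by exact_mod_cast (by omega : 0 < n)
  have hf : (0 : ℝ) < k.factorial := by exact_mod_cast Nat.factorial_pos k
  have hc : ((n : ℝ) / 2) ^ k / k.factorial ≤ n.choose k := by
    refine le_trans ?_ (Nat.pow_le_choose k n)
    gcongr
    rw [div_le_iff₀ (by norm_num)]
    exact_mod_cast (by omega : n ≤ (n + 1 - k) * 2)
  rw [hp]
  calc (n : ℝ) = unsatConst k / n ^ (k - 1) * (((n : ℝ) / 2) ^ k / k.factorial) := by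
        have : (n : ℝ) ^ k = n ^ (k - 1) * n := by
          rw [← pow_succ, Nat.sub_add_cancel (by omega)]
        rw [unsatConst, div_pow, this]
        field_simp
    _ ≤ _ := by
        gcongr
        exact div_nonneg (zero_le_one.trans (one_le_unsatConst k)) (by positivity)

lemma tendsto_satisfiable_unsatProb {k : ℕ} (hk : 2 ≤ k) :
    Tendsto (fun n => (randomFormula k n (unsatProb k n)).real {Φ | Satisfiable Φ})
      atTop (𝓝 0) := by
  -- The `2 ^ n` assignments each survive with probability at most `e^(-n)`, and `2 < e`.
  have hlim : Tendsto (fun n : ℕ => (2 * Real.exp (-1)) ^ n) atTop (𝓝 0) := by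
    refine tendsto_pow_atTop_nhds_zero_of_lt_one (by positivity) ?_
    rw [Real.exp_neg, ← div_eq_mul_inv, div_lt_one (Real.exp_pos 1)]
    linarith [Real.exp_one_gt_d9]
  refine squeeze_zero' (Eventually.of_forall fun n => MeasureTheory.measureReal_nonneg) ?_ hlim
  filter_upwards [eventually_le_unsatProb_mul_choose hk] with n hn
  refine (randomFormula_satisfiable_le k n _).trans ?_
  rw [mul_pow]
  gcongr
  calc (1 - unsatProb k n : ℝ) ^ n.choose k
      ≤ Real.exp (-unsatProb k n) ^ n.choose k := by
        refine pow_le_pow_left₀ (sub_nonneg.2 (unsatProb k n).2.2) ?_ _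
        linarith [Real.add_one_le_exp (-(unsatProb k n : ℝ))]
    _ = Real.exp (-(unsatProb k n * n.choose k)) := by
        rw [← Real.exp_nat_mul]; congr 1; ring
    _ ≤ Real.exp (-n) := Real.exp_le_exp.2 (neg_le_neg hn)
    _ = Real.exp (-1) ^ n := by rw [← Real.exp_nat_mul]; congr 1; ring

end KSAT

/-! ### Conclusion -/

theorem mainTheorem2 (k : ℕ) (hk : 3 ≤ k) :
    ∃ η : ℝ, 0 < η ∧ ∀ p : ℕ → unitInterval,
      Tendsto (fun n : ℕ => (KSAT.randomFormula k n (p n)).real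
        {Φ : KSAT.Formula n | KSAT.Satisfiable Φ}) atTop (𝓝 0) →
      Tendsto (fun n : ℕ => (KSAT.randomFormula k n (p n)).real
        {Φ : KSAT.Formula n | η ≤ ((KSAT.spine Φ).ncard : ℝ) / (n : ℝ)}) atTop (𝓝 1) := by
  open KSAT in
  have hD := one_le_unsatConst k
  refine ⟨spineDensity k (unsatConst k), spineDensity_pos (by omega) hD, fun p hp => ?_⟩
  set η := spineDensity k (unsatConst k)
  -- For each `n` this is one of two probabilities that both force unsatisfiability whp, and it is
  -- always `O(n^(1-k))`.
  set q : ℕ → I := fun n => min (p n) (unsatProb k n)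
  have hdense := tendsto_sum_denseTerm hk hD (fun n => (q n : ℝ)) (fun n => (q n).2.1)
    (fun n => le_trans (Subtype.coe_le_coe.2 (min_le_right _ _)) (unsatProb_le k n))
  have hlow := tendsto_const_nhds (x := (1 : ℝ)) |>.sub
    ((hp.add (tendsto_satisfiable_unsatProb (by omega : 2 ≤ k))).add hdense)
  simp only [add_zero, sub_zero] at hlow
  refine tendsto_of_tendsto_of_tendsto_of_le_of_le' hlow tendsto_const_nhds ?_
    (Eventually.of_forall fun n => MeasureTheory.measureReal_le_one)
  filter_upwards [eventually_gt_atTop 0] with n hn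
  have h1 := one_le_sat_add_spine_add_dense (by omega : 0 < k) hn (q n) η
  have h2 : (randomFormula k n (q n)).real {Φ | Satisfiable Φ} ≤
      (randomFormula k n (p n)).real {Φ | Satisfiable Φ} +
      (randomFormula k n (unsatProb k n)).real {Φ | Satisfiable Φ} := by
    rcases min_choice (p n) (unsatProb k n) with h | h <;> simp only [q, h]
    · exact le_add_of_nonneg_right MeasureTheory.measureReal_nonneg
    · exact le_add_of_nonneg_left MeasureTheory.measureReal_nonneg
  have h3 : (randomFormula k n (q n)).real {Φ | η ≤ ((spine Φ).ncard : ℝ) / n} ≤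
      (randomFormula k n (p n)).real {Φ | η ≤ ((spine Φ).ncard : ℝ) / n} := by
    refine setBernoulli_real_mono _ (min_le_left _ _) fun Φ Ψ hΦΨ hΦ => ?_
    refine le_trans (show η ≤ ((spine Φ).ncard : ℝ) / n from hΦ) ?_
    have := Set.ncard_le_ncard (spine_mono hΦΨ) (Set.toFinite _)
    exact div_le_div_of_nonneg_right (by exact_mod_cast this) (Nat.cast_nonneg n)
  linarith
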